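/- Let $p$ be a prime, $q=p^r$, and let $B=(b_1,\dots,b_r)$ be an $\mathbb F_p$-basis of $\mathbb F_q$. Let $\mathcal C\subseteq\mathbb F_q^n$ be a linear code and $H=(h_{jl})\in\mathbb F_q^{m\times n}$ a matrix with $\mathcal C=\{c\in\mathbb F_q^n \mid cH^T=0\}$ (for instance a parity check matrix, $m=n-k$). Let $H_e\in\mathbb F_p^{mr\times nr}$ be obtained from $H$ by replacing each entry $h_{jl}$ with the $r\times r$ block whose $s$-th column is the coordinate vector of $h_{jl}b_s$ with respect to $B$, and let $\triangle H_e$ be any integer matrix with $\triangle H_e\equiv H_e \pmod p$. Let $\mathbb K$ be any field, and let $\mathbf x=(x_{ij})$, $\mathbf y=(y_{ij})$ ($1\le i\le n$, $1\le j\le r$) and $\mathbf z=(z_1,\dots,z_{mr})$ be variables. The ordinary code ideal of $\mathcal C$ is $$I(\mathcal C)=\langle \mathbf x^{c}-\mathbf x^{c'}\mid c,c'\in\mathbb F_q^n,\ c-c'\in\mathcal C\rangle+\langle x_{ij}^p-1\mid 1\le i\le n,\ 1\le j\le r\rangle\subseteq\mathbb K[\mathbf x],$$ where the exponent of $x_{ij}$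 in $\mathbf x^c$ is the representative in $\{0,\dots,p-1\}$ of the $j$-th coordinate of $c_i$ with respect to $B$. The toric ideal of an integer matrix $A$ is $I_A=\langle \mathbf w^u-\mathbf w^v\mid Au=Av\rangle$, with $u,v$ vectors of non-negative integers and one variable $w_i$ for each column of $A$. The $p$-Lawrence lifting of $\triangle H_e$ is $$\Lambda(H_e)_p=\begin{pmatrix}\triangle H_e&\mathbf 0&pI_{mr}\\ I_{nr}&I_{nr}&\mathbf 0\end{pmatrix},$$ its columns corresponding to $\mathbf x,\mathbf y,\mathbf z$, and $I_{\Lambda(H_e)}=\{g(\mathbf x,\mathbf y,\mathbf 1)\mid g\in I_{\Lambda(H_e)_p}\}\subseteq\mathbb K[\mathbf x,\mathbf y]$. A binomial in an ideal $I$ is an element $\mathbf x^u-\mathbf x^v\in I$ with $\mathbf x^u\ne\mathbf x^v$ relatively prime; it is primitive if there is no other binomial $\mathbf x^{u'}-\mathbf x^{v'}$ in $I$ with $\mathbf x^{u'}\mid\mathbf x^u$ and $\mathbf x^{v'}\mid\mathbf x^v$. The Graver basis of $I$ is the set of all primitive binomials in $I$. Let $\mathcal G$ be the reduced Gröbner basis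 of $I_{\Lambda(H_e)}$ with respect to any monomial order on $\mathbb K[\mathbf x,\mathbf y]$, and put $\mathcal S=\{\mathbf x^u-\mathbf x^v\mid \mathbf x^u\mathbf y^v-\mathbf x^v\mathbf y^u\in\mathcal G\}$. Then the Graver basis of $I(\mathcal C)$ is $\mathcal S$ up to sign, that is, it equals $\mathcal S\cup(-\mathcal S)$. Moreover $\mathcal S=\{g(\mathbf x,\mathbf 1)\mid g\in\mathcal G\}$, the set obtained from $\mathcal G$ by substituting $\mathbf y\mapsto\mathbf 1$. -/

import Mathlib

namespace CodeGraver

open MvPolynomial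

noncomputable section

/-! ### Binomials, Graver bases, toric ideals and reduced Gröbner bases -/

/-- The difference of monomials `x^u - x^v` in `K[σ]`. -/
def binom {σ : Type*} (K : Type*) [Field K] (u v : σ →₀ ℕ) : MvPolynomial σ K :=
  monomial u 1 - monomial v 1

/-- `x^u - x^v` is a (pure) binomial lying in `I`: it has two terms, the two monomials are
relatively prime, and it belongs to `I`. -/
def IsBinomIn {σ K : Type*} [Field K] (I : Ideal (MvPolynomial σ K)) (u v : σ →₀ ℕ) : Prop :=
  u ≠ v ∧ Disjoint u.support v.support ∧ binom K u v ∈ I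

/-- The binomial `x^u - x^v` of `I` is primitive: there is no other binomial `x^u' - x^v'` in `I`
with `x^u' ∣ x^u` and `x^v' ∣ x^v`. -/
def IsPrimitive {σ K : Type*} [Field K] (I : Ideal (MvPolynomial σ K)) (u v : σ →₀ ℕ) : Prop :=
  IsBinomIn I u v ∧
    ∀ u' v' : σ →₀ ℕ, IsBinomIn I u' v' → u' ≤ u → v' ≤ v → u' = u ∧ v' = v

/-- The Graver basis of `I`: the set of all primitive binomials in `I`.  With this definition
it is closed under negation. -/
def graverBasis {σ K : Type*} [Field K] (I : Ideal (MvPolynomial σ K)) :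
    Set (MvPolynomial σ K) :=
  {f | ∃ u v : σ →₀ ℕ, IsPrimitive I u v ∧ f = binom K u v}

/-- The toric ideal `⟨x^u - x^v | A u = A v, u, v ∈ ℕ^σ⟩` of an integer matrix `A`. -/
def toricIdeal {ρ σ : Type*} [Fintype σ] (K : Type*) [Field K] (A : Matrix ρ σ ℤ) :
    Ideal (MvPolynomial σ K) :=
  Ideal.span {f | ∃ u v : σ →₀ ℕ,
    A.mulVec (fun s => (u s : ℤ)) = A.mulVec (fun s => (v s : ℤ)) ∧ f = binom K u v}

/-- `G` is the reduced Gröbner basis of `I` with respect to the monomial order `m`: a finite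
subset of `I` such that every leading monomial of a nonzero element of `I` is divisible by the
leading monomial of an element of `G`, all elements of `G` are monic, and no monomial occurring in
an element `g` of `G` is divisible by the leading monomial of another element of `G`. -/
structure IsReducedGroebnerBasis {σ K : Type*} [Field K] (m : MonomialOrder σ)
    (I : Ideal (MvPolynomial σ K)) (G : Set (MvPolynomial σ K)) : Prop where
  finite : G.Finite
  subset : G ⊆ (I : Set (MvPolynomial σ K))
  groebner : ∀ f ∈ I, f ≠ 0 → ∃ g ∈ G, m.degree g ≤ m.degree f
  monic : ∀ g ∈ G, m.Monic g
  reduced : ∀ g ∈ G, ∀ u ∈ g.support, ∀ g' ∈ G, g' ≠ g → ¬ m.degree g' ≤ u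

/-! ### The Lawrence lifting -/

/-- The `p`-Lawrence lifting `[[A, 0, p·1], [1, 1, 0]]` of `A`.  The three groups of columns
`(σ ⊕ σ) ⊕ ρ` correspond to the variables `x`, `y` and `z`. -/
def lawrenceLift {ρ σ : Type*} [DecidableEq ρ] [DecidableEq σ] (p : ℕ) (A : Matrix ρ σ ℤ) :
    Matrix (ρ ⊕ σ) ((σ ⊕ σ) ⊕ ρ) ℤ :=
  Matrix.fromBlocks (Matrix.fromCols A 0) ((p : ℤ) • 1) (Matrix.fromCols 1 1) 0

/-- The substitution `v ↦ 1` in the second group of variables, `g(w, v) ↦ g(w, 1)`. -/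
def substOne {α β : Type*} (K : Type*) [Field K] :
    MvPolynomial (α ⊕ β) K →ₐ[K] MvPolynomial α K :=
  aeval (Sum.elim X (fun _ => 1))

/-- The ideal `{g(x, y, 1) | g ∈ I_Λ}` of `K[x, y]`, where `I_Λ ⊆ K[x, y, z]` is the toric ideal of
the `p`-Lawrence lifting of `A`. -/
def lawrenceIdeal {ρ σ : Type*} [Fintype ρ] [Fintype σ] [DecidableEq ρ] [DecidableEq σ]
    (K : Type*) [Field K] (p : ℕ) (A : Matrix ρ σ ℤ) : Ideal (MvPolynomial (σ ⊕ σ) K) :=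
  (toricIdeal K (lawrenceLift p A)).map (substOne K)

theorem substOne_surjective {α β : Type*} (K : Type*) [Field K] :
    Function.Surjective (substOne K : MvPolynomial (α ⊕ β) K →ₐ[K] MvPolynomial α K) := by
  intro f
  refine ⟨rename Sum.inl f, ?_⟩
  unfold substOne
  rw [aeval_rename]
  simp [Function.comp_def]

theorem mem_lawrenceIdeal {ρ σ : Type*} [Fintype ρ] [Fintype σ] [DecidableEq ρ] [DecidableEq σ]
    (K : Type*) [Field K] (p : ℕ) (A : Matrix ρ σ ℤ) (f : MvPolynomial (σ ⊕ σ) K) :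
    f ∈ lawrenceIdeal K p A ↔ ∃ g ∈ toricIdeal K (lawrenceLift p A), substOne K g = f :=
  Ideal.mem_map_iff_of_surjective (substOne K) (substOne_surjective K)

/-- The polynomial `x^u y^v - x^v y^u` in `K[x, y]`. -/
def swapBinom {σ : Type*} (K : Type*) [Field K] (u v : σ →₀ ℕ) : MvPolynomial (σ ⊕ σ) K :=
  binom K (Finsupp.sumElim u v) (Finsupp.sumElim v u)

/-- The set `{x^u - x^v | x^u y^v - x^v y^u ∈ G}`. -/
def dehomogenized {σ K : Type*} [Field K] (G : Set (MvPolynomial (σ ⊕ σ) K)) :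
    Set (MvPolynomial σ K) :=
  {f | ∃ u v : σ →₀ ℕ, swapBinom K u v ∈ G ∧ f = binom K u v}

/-! ### Linear codes over `F = 𝔽_q`, `q = p ^ r`, with a fixed `𝔽_p`-basis `B` of `F` -/

/-- The exponent vector of a word `c ∈ F^n`: the canonical integer representatives in
`{0, …, p - 1}` of the coordinates of the entries of `c` with respect to `B`. -/
def wordExp {p n r : ℕ} {F : Type*} [Field F] [Algebra (ZMod p) F]
    (B : Module.Basis (Fin r) (ZMod p) F) (c : Fin n → F) : Fin n × Fin r →₀ ℕ :=
  Finsupp.equivFunOnFinite.symm fun ij => (B.repr (c ij.1) ij.2).val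

/-- The ordinary code ideal
`⟨x^c - x^c' | c - c' ∈ C⟩ + ⟨x_ij ^ p - 1 | 1 ≤ i ≤ n, 1 ≤ j ≤ r⟩`. -/
def codeIdeal {p n r : ℕ} {F : Type*} [Field F] [Algebra (ZMod p) F] (K : Type*) [Field K]
    (B : Module.Basis (Fin r) (ZMod p) F) (C : Submodule F (Fin n → F)) :
    Ideal (MvPolynomial (Fin n × Fin r) K) :=
  Ideal.span {f | ∃ c c' : Fin n → F, c - c' ∈ C ∧ f = binom K (wordExp B c) (wordExp B c')} ⊔
    Ideal.span {f | ∃ ij : Fin n × Fin r, f = X ij ^ p - 1}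

/-- The expansion `H_e` of `H` over `𝔽_p`: each entry `h` of `H` is replaced by the `r × r` block
whose `s`-th column is the coordinate vector of `h * b_s` with respect to `B = (b_1, …, b_r)`, that
is, by the matrix of the multiplication by `h`. -/
def expansion {p m n r : ℕ} {F : Type*} [Field F] [Algebra (ZMod p) F]
    (B : Module.Basis (Fin r) (ZMod p) F) (H : Matrix (Fin m) (Fin n) F) :
    Matrix (Fin m × Fin r) (Fin n × Fin r) (ZMod p) :=
  Matrix.of fun ji ls => B.repr (H ji.1 ls.1 * B ls.2) ji.2

end

end CodeGraver

/-!
The code ideal and the Lawrence ideal are both spanned by the binomials `x^u - x^v` with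
`φ u = φ v`, for an additive homomorphism `φ` on exponents. For the code ideal `φ u = A u mod p` (`codeIdeal_eq_binomialIdeal`):
modulo `x_ij ^ p = 1` every monomial belongs to a word, and two words have the same image exactly
when they differ by a codeword. For the Lawrence ideal `φ (u, v) = (A u mod p, u + v)`
(`lawrenceIdeal_eq_binomialIdeal`). In such an ideal the coefficients of an element sum to zero over
each fibre of `φ`, so the leading monomial of an element shares its fibre with a smaller monomial of
that element. Reducedness therefore makes each element of a reduced Gröbner basis a binomial, and
its two monomials are relatively prime since common factors cancel
(`IsReducedGroebnerBasis.exists_eq_binom`).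

In the Lawrence ideal, two relatively prime monomials of one fibre have the form `x^u y^v` and
`x^v y^u`. The binomials of the code ideal below `x^u - x^v` are exactly those whose
homogenizations have both monomials dividing the two monomials of `x^u y^v - x^v y^u`, in order.
So if `x^u - x^v` were not primitive, one of the two monomials would be reducible by a smaller
leading monomial, which reducedness forbids (`IsReducedGroebnerBasis.exists_eq_swapBinom`).
Conversely the leading monomial of the homogenization of a primitive binomial is divisible by a
leading monomial of the basis, which by primitivity is the same one, so the homogenization is in the
basis up to sign (`IsReducedGroebnerBasis.swapBinom_mem_or`). The monomial order plays no role
beyond the choice of signs.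
-/

namespace CodeGraver

open MvPolynomial

noncomputable section

/-! ### Binomial ideals of additive homomorphisms -/

/-- The ideal spanned by the binomials `x^u - x^v` with `φ u = φ v`, that is, the kernel of the
map `K[σ] → K[M]` of monoid algebras induced by `φ`. -/
def binomialIdeal {σ M : Type*} (K : Type*) [Field K] [AddCommMonoid M] (φ : (σ →₀ ℕ) →+ M) :
    Ideal (MvPolynomial σ K) :=
  Ideal.span {f | ∃ u v : σ →₀ ℕ, φ u = φ v ∧ f = binom K u v}

section binomialIdeal

variable {σ M K : Type*} [Field K] [AddCommMonoid M] {φ : (σ →₀ ℕ) →+ M}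

/-- The algebra map `K[σ] → K[M]`, `x^u ↦ single (φ u) 1`. -/
def classHom (K : Type*) [Field K] (φ : (σ →₀ ℕ) →+ M) :
    MvPolynomial σ K →ₐ[K] AddMonoidAlgebra K M :=
  AddMonoidAlgebra.mapDomainAlgHom K K φ

theorem classHom_monomial (u : σ →₀ ℕ) (c : K) :
    classHom K φ (monomial u c) = AddMonoidAlgebra.single (φ u) c :=
  AddMonoidAlgebra.mapDomain_single

theorem classHom_eq_zero {f : MvPolynomial σ K} (hf : f ∈ binomialIdeal K φ) :
    classHom K φ f = 0 := by
  have h : binomialIdeal K φ ≤ RingHom.ker (classHom K φ) := by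
    refine Ideal.span_le.2 ?_
    rintro _ ⟨u, v, huv, rfl⟩
    simp [binom, classHom_monomial, huv]
  exact h hf

/-- In an element of a binomial ideal the coefficients of each fibre of `φ` sum to zero, so that no
monomial is alone in its fibre. -/
theorem exists_mem_support_of_mem_binomialIdeal {f : MvPolynomial σ K}
    (hf : f ∈ binomialIdeal K φ) {s : σ →₀ ℕ} (hs : s ∈ f.support) :
    ∃ t ∈ f.support, t ≠ s ∧ φ t = φ s := by
  classical
  by_contra! h
  have h0 := classHom_eq_zero hf
  rw [f.as_sum, map_sum] at h0
  simp only [classHom_monomial] at h0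
  have h1 := congrArg (fun g : AddMonoidAlgebra K M => g.coeff (φ s)) h0
  simp only [AddMonoidAlgebra.coeff_sum, AddMonoidAlgebra.coeff_single, Finsupp.finsetSum_apply,
    AddMonoidAlgebra.coeff_zero, Finsupp.zero_apply] at h1
  rw [Finset.sum_eq_single_of_mem s hs] at h1
  · rw [Finsupp.single_eq_same] at h1
    exact mem_support_iff.1 hs h1
  · intro t ht hts
    rw [Finsupp.single_apply, if_neg (h t ht hts)]

theorem coeff_binom_left {u v : σ →₀ ℕ} (h : u ≠ v) : coeff u (binom K u v) = 1 := by
  classical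
  simp [binom, coeff_monomial, h.symm]

theorem eq_or_eq_of_mem_support_binom {u v w : σ →₀ ℕ} (h : w ∈ (binom K u v).support) :
    w = u ∨ w = v := by
  classical
  by_contra! hw
  refine mem_support_iff.1 h ?_
  simp [binom, coeff_monomial, hw.1.symm, hw.2.symm]

theorem binom_ne_zero {u v : σ →₀ ℕ} (h : u ≠ v) : binom K u v ≠ 0 := by
  intro h0
  have := coeff_binom_left (K := K) h
  simp [h0] at this

theorem neg_binom (u v : σ →₀ ℕ) : -binom K u v = binom K v u := neg_sub _ _

theorem binom_mem_binomialIdeal {u v : σ →₀ ℕ} : binom K u v ∈ binomialIdeal K φ ↔ φ u = φ v := by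
  refine ⟨fun h => ?_, fun h => Ideal.subset_span ⟨u, v, h, rfl⟩⟩
  by_cases huv : u = v
  · rw [huv]
  have hu : u ∈ (binom K u v).support := by
    rw [mem_support_iff, coeff_binom_left huv]
    exact one_ne_zero
  obtain ⟨t, ht, htu, hφ⟩ := exists_mem_support_of_mem_binomialIdeal h hu
  rcases eq_or_eq_of_mem_support_binom ht with rfl | rfl
  · exact absurd rfl htu
  · exact hφ.symm

theorem degree_binom (m : MonomialOrder σ) {u v : σ →₀ ℕ} (h : u ≠ v) :
    m.degree (binom K u v) = u ∨ m.degree (binom K u v) = v :=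
  eq_or_eq_of_mem_support_binom (m.degree_mem_support (binom_ne_zero h))

/-- An element of a reduced Gröbner basis of a binomial ideal is a binomial `x^d - x^t`, with
leading monomial `x^d` and a standard monomial `x^t`, since the leading monomial shares its fibre
with another monomial of the element. Its two monomials are relatively prime, since a common factor
may be cancelled within the ideal. -/
theorem IsReducedGroebnerBasis.exists_eq_binom [IsCancelAdd M] {m : MonomialOrder σ}
    {G : Set (MvPolynomial σ K)} (hG : IsReducedGroebnerBasis m (binomialIdeal K φ) G)
    {g : MvPolynomial σ K} (hg : g ∈ G) :
    ∃ d t : σ →₀ ℕ, g = binom K d t ∧ m.degree g = d ∧ d ≠ t ∧ φ d = φ t ∧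
      Disjoint d.support t.support ∧ ∀ g' ∈ G, ¬ m.degree g' ≤ t := by
  have hg0 : g ≠ 0 := (hG.monic g hg).ne_zero
  have hstd : ∀ t ∈ g.support, t ≠ m.degree g → ∀ g' ∈ G, ¬ m.degree g' ≤ t := by
    intro t ht htd g' hg' hle
    by_cases hgg : g' = g
    · subst hgg
      exact htd (m.toSyn.injective (le_antisymm (m.le_degree ht) (m.toSyn_monotone hle)))
    · exact hG.reduced g hg t ht g' hg' hgg hle
  obtain ⟨t, ht, htd, hφ⟩ := exists_mem_support_of_mem_binomialIdeal (hG.subset hg)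
    (m.degree_mem_support hg0)
  have hgb : g = binom K (m.degree g) t := by
    by_contra hne
    have hne' := sub_ne_zero.2 hne
    obtain ⟨g', hg', hle⟩ := hG.groebner _ (Ideal.sub_mem _ (hG.subset hg)
      (binom_mem_binomialIdeal.2 hφ.symm)) hne'
    have hmem := m.degree_mem_support hne'
    -- the monomials of the difference all occur in `g`, and its leading one is cancelled
    generalize m.degree (g - binom K (m.degree g) t) = e at hle hmem
    have hed : e ≠ m.degree g := by
      rintro rfl
      rw [mem_support_iff, coeff_sub, (hG.monic g hg).coeff_degree,
        coeff_binom_left htd.symm, sub_self] at hmem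
      exact hmem rfl
    have heg : e ∈ g.support := by
      classical
      rcases Finset.mem_union.1 (support_sub σ _ _ hmem) with h | h
      · exact h
      · rcases eq_or_eq_of_mem_support_binom h with h | h
        · exact absurd h hed
        · exact h ▸ ht
    exact hstd e heg hed g' hg' hle
  refine ⟨m.degree g, t, hgb, rfl, htd.symm, hφ.symm, ?_, hstd t ht htd⟩
  by_contra hdis
  obtain ⟨i, hid, hit⟩ := Finset.not_disjoint_iff.1 hdis
  rw [Finsupp.mem_support_iff] at hid hit
  have hd' : Finsupp.single i 1 ≤ m.degree g := by
    rw [Finsupp.single_le_iff]; omega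
  have ht' : Finsupp.single i 1 ≤ t := by
    rw [Finsupp.single_le_iff]; omega
  obtain ⟨d₁, hd₁⟩ := exists_add_of_le hd'
  obtain ⟨t₁, ht₁⟩ := exists_add_of_le ht'
  have hne : d₁ ≠ t₁ := by
    rintro rfl
    exact htd (ht₁.trans hd₁.symm)
  have hφ₁ : φ d₁ = φ t₁ := by
    rw [hd₁, ht₁, map_add, map_add] at hφ
    exact (add_left_cancel hφ).symm
  obtain ⟨g', hg', hle⟩ := hG.groebner _ (binom_mem_binomialIdeal.2 hφ₁) (binom_ne_zero hne)
  rcases degree_binom (K := K) m hne with h | h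
  · rw [h] at hle
    have hle' : m.degree g' ≤ m.degree g := by
      rw [hd₁]; exact hle.trans le_add_self
    have hgg : g' = g := by
      by_contra hgg
      exact hG.reduced g hg _ (m.degree_mem_support hg0) g' hg' hgg hle'
    subst hgg
    have h1 := hle i
    have h2 := DFunLike.congr_fun hd₁ i
    rw [Finsupp.add_apply, Finsupp.single_eq_same] at h2
    omega
  · rw [h] at hle
    refine hstd t ht htd g' hg' ?_
    rw [ht₁]; exact hle.trans le_add_self

end binomialIdeal

/-! ### The Graver basis as a reduced Gröbner basis of the Lawrence ideal -/

section lawrenceHom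

variable {σ M K : Type*} [Field K] [AddCommMonoid M]

/-- The homomorphism `(u, v) ↦ (ψ u, u + v)`, the Lawrence lifting of `ψ`. -/
def lawrenceHom (ψ : (σ →₀ ℕ) →+ M) : (σ ⊕ σ →₀ ℕ) →+ M × (σ →₀ ℕ) :=
  ((ψ.comp (AddMonoidHom.fst _ _)).prod (AddMonoidHom.fst _ _ + AddMonoidHom.snd _ _)).comp
    Finsupp.sumFinsuppAddEquivProdFinsupp.toAddMonoidHom

theorem lawrenceHom_sumElim (ψ : (σ →₀ ℕ) →+ M) (u v : σ →₀ ℕ) :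
    lawrenceHom ψ (Finsupp.sumElim u v) = (ψ u, u + v) := by
  have h : Finsupp.sumFinsuppAddEquivProdFinsupp (Finsupp.sumElim u v) = (u, v) :=
    Finsupp.sumFinsuppAddEquivProdFinsupp.right_inv (u, v)
  simp [lawrenceHom, h]

theorem exists_eq_sumElim (d : σ ⊕ σ →₀ ℕ) : ∃ u v : σ →₀ ℕ, d = Finsupp.sumElim u v :=
  ⟨_, _, (Finsupp.comapDomain_sumElim_comapDomain d).symm⟩

theorem sumElim_le_sumElim {u v u' v' : σ →₀ ℕ} :
    Finsupp.sumElim u v ≤ Finsupp.sumElim u' v' ↔ u ≤ u' ∧ v ≤ v' :=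
  ⟨fun h => ⟨fun i => h (Sum.inl i), fun i => h (Sum.inr i)⟩,
    fun h i => i.casesOn h.1 h.2⟩

theorem sumElim_swap_ne {u v : σ →₀ ℕ} (h : u ≠ v) :
    Finsupp.sumElim u v ≠ Finsupp.sumElim v u := fun h' =>
  h (Finsupp.ext fun i => DFunLike.congr_fun h' (Sum.inl i))

theorem swapBinom_mem {ψ : (σ →₀ ℕ) →+ M} {u v : σ →₀ ℕ} (h : ψ u = ψ v) :
    swapBinom K u v ∈ binomialIdeal K (lawrenceHom ψ) := by
  rw [swapBinom, binom_mem_binomialIdeal, lawrenceHom_sumElim, lawrenceHom_sumElim, h, add_comm]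

theorem isBinomIn_binomialIdeal {ψ : (σ →₀ ℕ) →+ M} {u v : σ →₀ ℕ} :
    IsBinomIn (binomialIdeal K ψ) u v ↔ u ≠ v ∧ Disjoint u.support v.support ∧ ψ u = ψ v := by
  rw [IsBinomIn, binom_mem_binomialIdeal]

theorem IsPrimitive.symm {ψ : (σ →₀ ℕ) →+ M} {u v : σ →₀ ℕ}
    (h : IsPrimitive (binomialIdeal K ψ) u v) : IsPrimitive (binomialIdeal K ψ) v u := by
  have hs : ∀ {u v : σ →₀ ℕ}, IsBinomIn (binomialIdeal K ψ) u v →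
      IsBinomIn (binomialIdeal K ψ) v u := fun h =>
    isBinomIn_binomialIdeal.2 ⟨h.1.symm, h.2.1.symm, (isBinomIn_binomialIdeal.1 h).2.2.symm⟩
  exact ⟨hs h.1, fun u' v' h' hu hv => (h.2 v' u' (hs h') hv hu).symm⟩

theorem monomial_substOne {α β : Type*} (u : α ⊕ β →₀ ℕ) :
    substOne K (monomial u (1 : K)) =
      monomial (u.comapDomain Sum.inl Sum.inl_injective.injOn) 1 := by
  rw [← Finsupp.comapDomain_sumElim_comapDomain u, substOne, aeval_monomial, Finsupp.prod_sumElim,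
    monomial_eq]
  simp [Function.comp_def]

theorem substOne_swapBinom (u v : σ →₀ ℕ) : substOne K (swapBinom K u v) = binom K u v := by
  simp [swapBinom, binom, monomial_substOne]

variable [IsCancelAdd M] {ψ : (σ →₀ ℕ) →+ M} {m : MonomialOrder (σ ⊕ σ)}
  {G : Set (MvPolynomial (σ ⊕ σ) K)}

/-- The elements of the reduced Gröbner basis come from primitive binomials: the monomials of
`x^u y^v - x^v y^u` are relatively prime, of the same degree `u + v` in the pairs of variables
`x_i, y_i`, which forces the shape, and a binomial below `(u, v)` would make one of the two
monomials reducible. -/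
theorem IsReducedGroebnerBasis.exists_eq_swapBinom
    (hG : IsReducedGroebnerBasis m (binomialIdeal K (lawrenceHom ψ)) G)
    {g : MvPolynomial (σ ⊕ σ) K} (hg : g ∈ G) :
    ∃ u v : σ →₀ ℕ, g = swapBinom K u v ∧ m.degree g = Finsupp.sumElim u v ∧
      IsPrimitive (binomialIdeal K ψ) u v := by
  obtain ⟨d, t, rfl, hd, hne, hφ, hdis, hstd⟩ := hG.exists_eq_binom hg
  obtain ⟨u, v, rfl⟩ := exists_eq_sumElim d
  obtain ⟨u', v', rfl⟩ := exists_eq_sumElim t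
  rw [lawrenceHom_sumElim, lawrenceHom_sumElim, Prod.mk.injEq] at hφ
  have hdis' : ∀ i, Finsupp.sumElim u v i = 0 ∨ Finsupp.sumElim u' v' i = 0 := by
    intro i
    by_contra! h
    exact Finset.disjoint_left.1 hdis (Finsupp.mem_support_iff.2 h.1)
      (Finsupp.mem_support_iff.2 h.2)
  have key : ∀ i, u' i = v i ∧ v' i = u i := by
    intro i
    have h1 := hdis' (Sum.inl i)
    have h2 := hdis' (Sum.inr i)
    have h3 := DFunLike.congr_fun hφ.2 i
    simp only [Finsupp.sumElim_inl, Finsupp.sumElim_inr, Finsupp.add_apply] at h1 h2 h3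
    omega
  obtain rfl : u' = v := Finsupp.ext fun i => (key i).1
  obtain rfl : v' = u := Finsupp.ext fun i => (key i).2
  have hne' : v' ≠ u' := by
    rintro rfl
    exact hne rfl
  refine ⟨v', u', rfl, hd, isBinomIn_binomialIdeal.2 ⟨hne', ?_, hφ.1⟩, ?_⟩
  · rw [Finset.disjoint_left]
    intro i h1 h2
    have := hdis' (Sum.inl i)
    simp only [Finsupp.sumElim_inl] at this
    rw [Finsupp.mem_support_iff] at h1 h2
    tauto
  · intro a b hab ha hb
    obtain ⟨hne₁, -, hψ⟩ := isBinomIn_binomialIdeal.1 hab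
    obtain ⟨g', hg', hle⟩ := hG.groebner _ (swapBinom_mem hψ)
      (binom_ne_zero (sumElim_swap_ne hne₁))
    rcases degree_binom (K := K) m (sumElim_swap_ne hne₁) with h | h <;> rw [swapBinom, h] at hle
    · have hle' := hle.trans (sumElim_le_sumElim.2 ⟨ha, hb⟩)
      have hgg : g' = binom K (Finsupp.sumElim v' u') (Finsupp.sumElim u' v') := by
        by_contra hgg
        refine hG.reduced _ hg _ ?_ g' hg' hgg hle'
        rw [mem_support_iff, coeff_binom_left hne]
        exact one_ne_zero
      rw [hgg, hd, sumElim_le_sumElim] at hle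
      exact ⟨le_antisymm ha hle.1, le_antisymm hb hle.2⟩
    · exact absurd (hle.trans (sumElim_le_sumElim.2 ⟨hb, ha⟩)) (hstd g' hg')

theorem IsReducedGroebnerBasis.swapBinom_mem_of_degree_eq
    (hG : IsReducedGroebnerBasis m (binomialIdeal K (lawrenceHom ψ)) G) {u v : σ →₀ ℕ}
    (h : IsPrimitive (binomialIdeal K ψ) u v)
    (hdeg : m.degree (swapBinom K u v) = Finsupp.sumElim u v) : swapBinom K u v ∈ G := by
  obtain ⟨hne, -, hψ⟩ := isBinomIn_binomialIdeal.1 h.1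
  obtain ⟨g, hg, hle⟩ := hG.groebner _ (swapBinom_mem hψ) (binom_ne_zero (sumElim_swap_ne hne))
  obtain ⟨u', v', rfl, hd, hp⟩ := hG.exists_eq_swapBinom hg
  rw [hd, hdeg, sumElim_le_sumElim] at hle
  obtain ⟨rfl, rfl⟩ := h.2 u' v' hp.1 hle.1 hle.2
  exact hg

/-- One of the two signs of a primitive binomial is monic after homogenization. -/
theorem IsReducedGroebnerBasis.swapBinom_mem_or
    (hG : IsReducedGroebnerBasis m (binomialIdeal K (lawrenceHom ψ)) G) {u v : σ →₀ ℕ}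
    (h : IsPrimitive (binomialIdeal K ψ) u v) : swapBinom K u v ∈ G ∨ swapBinom K v u ∈ G := by
  rcases degree_binom (K := K) m (sumElim_swap_ne h.1.1) with hd | hd
  · exact Or.inl (hG.swapBinom_mem_of_degree_eq h hd)
  · refine Or.inr (hG.swapBinom_mem_of_degree_eq h.symm ?_)
    rw [swapBinom, ← neg_binom, m.degree_neg, hd]

theorem IsReducedGroebnerBasis.substOne_image
    (hG : IsReducedGroebnerBasis m (binomialIdeal K (lawrenceHom ψ)) G) :
    substOne K '' G = dehomogenized G := by
  ext f
  constructor
  · rintro ⟨g, hg, rfl⟩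
    obtain ⟨u, v, rfl, -, -⟩ := hG.exists_eq_swapBinom hg
    exact ⟨u, v, hg, substOne_swapBinom u v⟩
  · rintro ⟨u, v, hg, rfl⟩
    exact ⟨_, hg, substOne_swapBinom u v⟩

theorem IsReducedGroebnerBasis.graverBasis_eq
    (hG : IsReducedGroebnerBasis m (binomialIdeal K (lawrenceHom ψ)) G) :
    graverBasis (binomialIdeal K ψ) = dehomogenized G ∪ Neg.neg '' dehomogenized G := by
  have hsub : ∀ f ∈ dehomogenized G, ∃ u v, IsPrimitive (binomialIdeal K ψ) u v ∧
      f = binom K u v := by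
    intro f hf
    rw [← hG.substOne_image] at hf
    obtain ⟨g, hg, rfl⟩ := hf
    obtain ⟨u, v, rfl, -, h⟩ := hG.exists_eq_swapBinom hg
    exact ⟨u, v, h, substOne_swapBinom u v⟩
  refine Set.Subset.antisymm ?_ (Set.union_subset hsub ?_)
  · rintro _ ⟨u, v, h, rfl⟩
    rcases hG.swapBinom_mem_or h with h' | h'
    · exact Or.inl ⟨u, v, h', rfl⟩
    · exact Or.inr ⟨_, ⟨v, u, h', rfl⟩, neg_binom v u⟩
  · rintro _ ⟨f, hf, rfl⟩
    obtain ⟨u, v, h, rfl⟩ := hsub f hf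
    exact ⟨v, u, h.symm, neg_binom u v⟩

end lawrenceHom

/-! ### The code ideal and its Lawrence ideal as binomial ideals -/

/-- The homomorphism `u ↦ A u mod p`. -/
def syndromeHom {ρ σ : Type*} [Fintype σ] (p : ℕ) (A : Matrix ρ σ ℤ) :
    (σ →₀ ℕ) →+ (ρ → ZMod p) where
  toFun u := (A.map (Int.cast : ℤ → ZMod p)).mulVec fun s => (u s : ZMod p)
  map_zero' := by
    ext i
    simp [Matrix.mulVec, dotProduct]
  map_add' u v := by
    ext i
    simp [Matrix.mulVec, dotProduct, mul_add, Finset.sum_add_distrib]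

theorem syndromeHom_apply {ρ σ : Type*} [Fintype σ] (p : ℕ) (A : Matrix ρ σ ℤ) (u : σ →₀ ℕ)
    (i : ρ) : syndromeHom p A u i = ((A.mulVec (fun s => (u s : ℤ)) i : ℤ) : ZMod p) := by
  simp [syndromeHom, Matrix.mulVec, dotProduct]

theorem syndromeHom_congr {ρ σ : Type*} [Fintype σ] {p : ℕ} (A : Matrix ρ σ ℤ) {u v : σ →₀ ℕ}
    (h : ∀ s, (u s : ZMod p) = v s) : syndromeHom p A u = syndromeHom p A v :=
  congrArg (A.map (Int.cast : ℤ → ZMod p)).mulVec (funext h)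

section lawrenceIdeal

variable {ρ σ : Type*} [Fintype ρ] [Fintype σ] [DecidableEq ρ] [DecidableEq σ]

theorem lawrenceLift_mulVec_inl (p : ℕ) (A : Matrix ρ σ ℤ) (w : (σ ⊕ σ) ⊕ ρ → ℤ) (i : ρ) :
    (lawrenceLift p A).mulVec w (Sum.inl i) =
      A.mulVec (fun s => w (Sum.inl (Sum.inl s))) i + p * w (Sum.inr i) := by
  simp [lawrenceLift, Matrix.mulVec, dotProduct, Matrix.natCast_apply]

theorem lawrenceLift_mulVec_inr (p : ℕ) (A : Matrix ρ σ ℤ) (w : (σ ⊕ σ) ⊕ ρ → ℤ) (s : σ) :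
    (lawrenceLift p A).mulVec w (Sum.inr s) =
      w (Sum.inl (Sum.inl s)) + w (Sum.inl (Sum.inr s)) := by
  simp [lawrenceLift, Matrix.mulVec, dotProduct, Matrix.one_apply]

/-- Setting the variables `z` to `1` turns the equations of the columns `p • 1` into congruences
modulo `p`: the exponents of `z` can absorb any multiple of `p`, on the one side or the other. -/
theorem lawrenceIdeal_eq_binomialIdeal (K : Type*) [Field K] (p : ℕ) (A : Matrix ρ σ ℤ) :
    lawrenceIdeal K p A = binomialIdeal K (lawrenceHom (syndromeHom p A)) := by
  rw [lawrenceIdeal, toricIdeal, Ideal.map_span]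
  refine le_antisymm (Ideal.span_le.2 ?_) (Ideal.span_le.2 ?_)
  · rintro _ ⟨_, ⟨u, v, huv, rfl⟩, rfl⟩
    obtain ⟨u, c, rfl⟩ : ∃ a b, u = Finsupp.sumElim a b :=
      ⟨_, _, (Finsupp.comapDomain_sumElim_comapDomain u).symm⟩
    obtain ⟨v, c', rfl⟩ : ∃ a b, v = Finsupp.sumElim a b :=
      ⟨_, _, (Finsupp.comapDomain_sumElim_comapDomain v).symm⟩
    obtain ⟨a, b, rfl⟩ := exists_eq_sumElim u
    obtain ⟨a', b', rfl⟩ := exists_eq_sumElim v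
    have h : substOne K (binom K (Finsupp.sumElim (Finsupp.sumElim a b) c)
        (Finsupp.sumElim (Finsupp.sumElim a' b') c')) =
        binom K (Finsupp.sumElim a b) (Finsupp.sumElim a' b') := by
      simp [binom, monomial_substOne]
    rw [SetLike.mem_coe]
    change substOne K _ ∈ _
    rw [h, binom_mem_binomialIdeal, lawrenceHom_sumElim, lawrenceHom_sumElim, Prod.mk.injEq]
    constructor
    · ext i
      have hi := congrFun huv (Sum.inl i)
      rw [lawrenceLift_mulVec_inl, lawrenceLift_mulVec_inl] at hi
      have hi' := congrArg (Int.cast : ℤ → ZMod p) hi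
      simpa [syndromeHom_apply] using hi'
    · ext s
      have hs := congrFun huv (Sum.inr s)
      rw [lawrenceLift_mulVec_inr, lawrenceLift_mulVec_inr] at hs
      simp only [Finsupp.sumElim_inl, Finsupp.sumElim_inr] at hs
      rw [Finsupp.add_apply, Finsupp.add_apply]
      exact_mod_cast hs
  · rintro _ ⟨u, v, huv, rfl⟩
    obtain ⟨a, b, rfl⟩ := exists_eq_sumElim u
    obtain ⟨a', b', rfl⟩ := exists_eq_sumElim v
    rw [lawrenceHom_sumElim, lawrenceHom_sumElim, Prod.mk.injEq] at huv
    have hk : ∀ i, ∃ k : ℤ, A.mulVec (fun s => (a s : ℤ)) i =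
        A.mulVec (fun s => (a' s : ℤ)) i + p * k := by
      intro i
      have hi := congrFun huv.1 i
      rw [syndromeHom_apply, syndromeHom_apply, ZMod.intCast_eq_intCast_iff_dvd_sub] at hi
      obtain ⟨k, hk⟩ := hi
      exact ⟨-k, by linarith⟩
    choose k hk using hk
    refine Ideal.subset_span ⟨_, ⟨Finsupp.sumElim (Finsupp.sumElim a b)
        (Finsupp.equivFunOnFinite.symm fun i => (-k i).toNat),
      Finsupp.sumElim (Finsupp.sumElim a' b')
        (Finsupp.equivFunOnFinite.symm fun i => (k i).toNat), ?_, rfl⟩, ?_⟩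
    · ext (i | s)
      · rw [lawrenceLift_mulVec_inl, lawrenceLift_mulVec_inl]
        simp only [Finsupp.sumElim_inl, Finsupp.sumElim_inr,
          Finsupp.equivFunOnFinite_symm_apply_apply]
        have h : k i = ((k i).toNat : ℤ) - ((-k i).toNat : ℤ) := by omega
        rw [hk i]
        linear_combination (p : ℤ) * h
      · rw [lawrenceLift_mulVec_inr, lawrenceLift_mulVec_inr]
        have hs := DFunLike.congr_fun huv.2 s
        simp only [Finsupp.add_apply] at hs
        simp only [Finsupp.sumElim_inl, Finsupp.sumElim_inr]
        exact_mod_cast hs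
    · change substOne K _ = _
      simp [binom, monomial_substOne]

end lawrenceIdeal

section codeIdeal

variable {p m n r : ℕ} [Fact p.Prime] {F : Type*} [Field F] [Algebra (ZMod p) F]
  (B : Module.Basis (Fin r) (ZMod p) F)

/-- The expansion of `H` is the matrix of `H` in coordinates over `𝔽_p`. -/
theorem expansion_mulVec (H : Matrix (Fin m) (Fin n) F) (c : Fin n → F) :
    (expansion B H).mulVec (fun ls => B.repr (c ls.1) ls.2) =
      fun ji => B.repr (H.mulVec c ji.1) ji.2 := by
  ext ⟨j, i⟩
  have h : H.mulVec c j =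
      ∑ l, ∑ s, B.repr (c l) s • (H j l * B s) := by
    simp only [Matrix.mulVec, dotProduct]
    refine Finset.sum_congr rfl fun l _ => ?_
    conv_lhs => rw [← B.sum_repr (c l)]
    rw [Finset.mul_sum]
    exact Finset.sum_congr rfl fun s _ => by rw [mul_smul_comm]
  simp only [h, map_sum, map_smul, Finsupp.coe_finsetSum, Finset.sum_apply, Finsupp.smul_apply,
    smul_eq_mul]
  rw [Matrix.mulVec, dotProduct, Fintype.sum_prod_type]
  exact Finset.sum_congr rfl fun l _ => Finset.sum_congr rfl fun s _ => mul_comm _ _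

/-- Since the expansion has the integer matrix `A` as a lift, `u ↦ A u mod p` separates words
exactly up to codewords. -/
theorem syndromeHom_wordExp_eq_iff {C : Submodule F (Fin n → F)} {H : Matrix (Fin m) (Fin n) F}
    (hH : ∀ c : Fin n → F, c ∈ C ↔ H.mulVec c = 0)
    {A : Matrix (Fin m × Fin r) (Fin n × Fin r) ℤ}
    (hA : A.map (Int.cast : ℤ → ZMod p) = expansion B H) {c c' : Fin n → F} :
    syndromeHom p A (wordExp B c) = syndromeHom p A (wordExp B c') ↔ c - c' ∈ C := by
  have h : ∀ c : Fin n → F, syndromeHom p A (wordExp B c) =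
      fun ji => B.repr (H.mulVec c ji.1) ji.2 := by
    intro c
    rw [← expansion_mulVec, ← hA]
    simp [syndromeHom, wordExp]
  rw [h, h, hH, Matrix.mulVec_sub, sub_eq_zero]
  constructor
  · intro h'
    ext j
    exact B.repr.injective (Finsupp.ext fun i => congrFun h' (j, i))
  · intro h'
    rw [h']

/-- Modulo the relations `x_ij ^ p = 1` every monomial is the monomial of a word. -/
theorem exists_wordExp (K : Type*) [Field K] (C : Submodule F (Fin n → F))
    (u : Fin n × Fin r →₀ ℕ) :
    ∃ c : Fin n → F, (∀ ij, ((wordExp B c ij : ℕ) : ZMod p) = u ij) ∧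
      binom K u (wordExp B c) ∈ codeIdeal K B C := by
  refine ⟨fun i => B.equivFun.symm fun j => (u (i, j) : ZMod p), ?_, ?_⟩
  · intro ij
    simp [wordExp, ← B.equivFun_apply, -Module.Basis.equivFun_symm_apply]
  · have hpow : ∀ ij : Fin n × Fin r,
        Ideal.Quotient.mk (codeIdeal K B C) (X ij) ^ p = 1 := by
      intro ij
      rw [← map_pow, ← map_one (Ideal.Quotient.mk _), Ideal.Quotient.eq]
      exact Ideal.mem_sup_right (Ideal.subset_span ⟨ij, rfl⟩)
    rw [binom, ← Ideal.Quotient.eq, monomial_eq, monomial_eq,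
      Finsupp.prod_fintype _ _ (fun _ => pow_zero _),
      Finsupp.prod_fintype _ _ (fun _ => pow_zero _)]
    simp only [map_mul, map_prod, map_pow]
    congr 1
    refine Finset.prod_congr rfl fun ij _ => ?_
    rw [pow_eq_pow_mod _ (hpow ij)]
    simp [wordExp, ← B.equivFun_apply, -Module.Basis.equivFun_symm_apply, ZMod.val_natCast]

theorem codeIdeal_eq_binomialIdeal (K : Type*) [Field K] {C : Submodule F (Fin n → F)}
    {H : Matrix (Fin m) (Fin n) F} (hH : ∀ c : Fin n → F, c ∈ C ↔ H.mulVec c = 0)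
    {A : Matrix (Fin m × Fin r) (Fin n × Fin r) ℤ}
    (hA : A.map (Int.cast : ℤ → ZMod p) = expansion B H) :
    codeIdeal K B C = binomialIdeal K (syndromeHom p A) := by
  refine le_antisymm (sup_le (Ideal.span_le.2 ?_) (Ideal.span_le.2 ?_)) (Ideal.span_le.2 ?_)
  · rintro _ ⟨c, c', h, rfl⟩
    exact binom_mem_binomialIdeal.2 ((syndromeHom_wordExp_eq_iff B hH hA).2 h)
  · rintro _ ⟨ij, rfl⟩
    have hX : (X ij ^ p - 1 : MvPolynomial (Fin n × Fin r) K) =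
        binom K (Finsupp.single ij p) 0 := by
      rw [binom, X_pow_eq_monomial]
      rfl
    rw [SetLike.mem_coe, hX, binom_mem_binomialIdeal]
    refine syndromeHom_congr A fun s => ?_
    by_cases hs : ij = s
    · subst hs; simp
    · simp [Finsupp.single_eq_of_ne' hs]
  · rintro _ ⟨u, v, huv, rfl⟩
    obtain ⟨c, hc, hu⟩ := exists_wordExp B K C u
    obtain ⟨c', hc', hv⟩ := exists_wordExp B K C v
    rw [← syndromeHom_congr A hc, ← syndromeHom_congr A hc',
      syndromeHom_wordExp_eq_iff B hH hA] at huv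
    have hcc : binom K (wordExp B c) (wordExp B c') ∈ codeIdeal K B C :=
      Ideal.mem_sup_left (Ideal.subset_span ⟨c, c', huv, rfl⟩)
    have h : binom K u v =
        binom K u (wordExp B c) + binom K (wordExp B c) (wordExp B c') -
          binom K v (wordExp B c') := by
      simp only [binom]
      ring
    rw [SetLike.mem_coe, h]
    exact Ideal.sub_mem _ (Ideal.add_mem _ hu hcc) hv

end codeIdeal

end

end CodeGraver

theorem mainTheorem2 {p n m r : ℕ} [Fact p.Prime]
    {F : Type*} [Field F] [Algebra (ZMod p) F]
    (B : Module.Basis (Fin r) (ZMod p) F)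
    (C : Submodule F (Fin n → F))
    (H : Matrix (Fin m) (Fin n) F) (hH : ∀ c : Fin n → F, c ∈ C ↔ H.mulVec c = 0)
    (A : Matrix (Fin m × Fin r) (Fin n × Fin r) ℤ)
    (hA : A.map (Int.cast : ℤ → ZMod p) = CodeGraver.expansion B H)
    (K : Type*) [Field K]
    (ord : MonomialOrder ((Fin n × Fin r) ⊕ (Fin n × Fin r)))
    (G : Set (MvPolynomial ((Fin n × Fin r) ⊕ (Fin n × Fin r)) K))
    (hG : CodeGraver.IsReducedGroebnerBasis ord (CodeGraver.lawrenceIdeal K p A) G) :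
    CodeGraver.graverBasis (CodeGraver.codeIdeal K B C) =
        CodeGraver.dehomogenized G ∪ Neg.neg '' CodeGraver.dehomogenized G ∧
      CodeGraver.substOne K '' G = CodeGraver.dehomogenized G := by
  rw [CodeGraver.lawrenceIdeal_eq_binomialIdeal] at hG
  rw [CodeGraver.codeIdeal_eq_binomialIdeal B K hH hA]
  exact ⟨hG.graverBasis_eq, hG.substOne_image⟩
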